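/- Let $(p_n)_{n\ge1}$ be a deterministic sequence in $[0,1]$ with $\sum_n p_n=\infty$ that is eventually periodic: there are $r\ge1$ and $n_0\in\mathbb{N}$ such that $p_{n+r}=p_n$ for all $n\ge n_0$. Let $Y_1,Y_2,\dots$ be the inhomogeneous Markov chain with values in the set $\{\pm \mathrm{e}_1,\pm \mathrm{e}_2\}$ of the four unit vectors of $\mathbb{Z}^2$ such that $Y_1$ is uniformly distributed on this set and the transition matrix between the times $n$ and $n+1$ is $(1-p_n)I+\frac{p_n}{4}A$ for every $n\ge1$, where $I$ is the $4\times4$ identity matrix and $A$ is the $4\times4$ matrix all of whose entries are $1$ (that is, with probability $p_n$ the direction is chosen afresh, uniformly among the four directions, and otherwise it is kept). Let $S_n=Y_1+\dots+Y_n$ be the corresponding two-dimensional conservative random walk started at the origin, and let $|\cdot|$ be the Euclidean norm. Then $S$ is not strongly transient, i.e. $\mathbb{P}(\lim_{n\to\infty}|S_n|=\infty)=1$ fails; in fact, $$\mathbb{P}\Big(\lim_{n\to\infty}|S_n|=\infty\Big)=0.$$ -/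

import Mathlib

open MeasureTheory Filter

namespace ConservativeWalk

/-- Labels of the `2 d` directions: `(i, true)` stands for `e_i`, `(i, false)` for `-e_i`. -/
abbrev Direction (d : ℕ) : Type := Fin d × Bool

/-- The unit vector `± e_i` of `ℤ^d` with a given label. -/
def unitVec {d : ℕ} (a : Direction d) : Fin d → ℤ :=
  if a.2 then Pi.single a.1 1 else -Pi.single a.1 1

/-- The `2 d × 2 d` matrix `(1 - q) I + q / (2 d) A`, where all entries of `A` are `1`: with
probability `q` the direction is chosen afresh, uniformly among all `2 d` directions, and
otherwise it is kept. -/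
noncomputable def stepMatrix (d : ℕ) (q : ℝ) : Matrix (Direction d) (Direction d) ℝ :=
  (1 - q) • (1 : Matrix (Direction d) (Direction d) ℝ)
    + (q / (2 * (d : ℝ))) • Matrix.of (fun _ _ => (1 : ℝ))

/-- `Y 1, Y 2, …` is an inhomogeneous Markov chain on the set of directions such that `Y 1` is
uniform and `stepMatrix d (p n)` is the transition matrix between the times `n` and `n + 1`,
for every `n ≥ 1`. (`Y 0` and `p 0` play no role.) The Markov property
`P(Y (n+1) = b | Y 1, …, Y n) = stepMatrix d (p n) (Y n) b` is written in multiplied-out form,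
for each initial trajectory `y 1, …, y n`. -/
structure IsDirectionChain {Ω : Type*} [MeasurableSpace Ω] (P : Measure Ω) (d : ℕ) (p : ℕ → ℝ)
    (Y : ℕ → Ω → Direction d) : Prop where
  measurable : ∀ n, 1 ≤ n → Measurable (Y n)
  initial : ∀ a : Direction d, P.real {ω | Y 1 ω = a} = 1 / (2 * (d : ℝ))
  markov : ∀ n, 1 ≤ n → ∀ y : ℕ → Direction d,
    P.real {ω | ∀ k ∈ Finset.Icc 1 (n + 1), Y k ω = y k} =
      P.real {ω | ∀ k ∈ Finset.Icc 1 n, Y k ω = y k} * stepMatrix d (p n) (y n) (y (n + 1))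

/-- The walk `S_n = z + Y_1 + … + Y_n` on `ℤ^d`, started at `z`. -/
def walk {Ω : Type*} {d : ℕ} (z : Fin d → ℤ) (Y : ℕ → Ω → Direction d) (n : ℕ) (ω : Ω) :
    Fin d → ℤ :=
  z + ∑ i ∈ Finset.Icc 1 n, unitVec (Y i ω)

/-- The Euclidean norm of a point of `ℤ^d`. -/
noncomputable def euclNorm {d : ℕ} (x : Fin d → ℤ) : ℝ :=
  ‖(WithLp.toLp 2 (fun i => (x i : ℝ)) : EuclideanSpace ℝ (Fin d))‖

/-- The event `lim_n |S_n| = ∞`. -/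
def escapeEvent {Ω : Type*} {d : ℕ} (S : ℕ → Ω → Fin d → ℤ) : Set Ω :=
  {ω | Tendsto (fun n => euclNorm (S n ω)) atTop atTop}

/-- Strong transience: `|S_n| → ∞` with probability one. -/
def StronglyTransient {Ω : Type*} [MeasurableSpace Ω] (P : Measure Ω) {d : ℕ}
    (S : ℕ → Ω → Fin d → ℤ) : Prop :=
  P (escapeEvent S) = 1

end ConservativeWalk

/-! The proof builds a Lyapunov function that tends to infinity with `|x|` and is a supermartingale
far from the origin. In the plane `log |x|²` is harmonic, and subtracting `|x|^(-1/2)` makes it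
strictly superharmonic: for the resulting profile `f`, `Δf = -|x|^(-5/2) / 4`. Third-order Taylor
errors are only `O(|x|⁻³)`, hence negligible against `Δf`.

Since the walk remembers its direction `y`, `f` alone is not a supermartingale. With time-dependent
coefficients, set `V_n = f + a_n ∂_y f + b_n ∂_y² f + g_n Δf`. A refreshed direction averages `∂_z
f` to `0` and `∂_z² f` to `Δf / 2`, so linear recursions for `a`, `b`, `g` turn the one-step drift
into `κ Δf + O(|x|⁻³)`. Periodicity gives bounded solutions with `κ > 0`: `a` and `b` solve
recursions contracting over a period, and `κ` is the mean over a period of the source term for `g`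
(`exists_coefficients`). The drift is then nonpositive outside a large ball (`exists_drift`).

Killed upon visiting that ball after time `N + K`, `V` has nonincreasing expectation
(`lintegral_stoppedLyapunov_succ_le`), so by Fatou its liminf is almost surely finite for every `K`.
On an escaping path some `K` sees no killing and `V` tends to infinity, so escape is null. -/

namespace ConservativeWalk

/-! ### Radial profile and its derivatives -/

/-- The radial profile of the Lyapunov function, as a function of `s = |x|²`. -/
noncomputable def profile (s : ℝ) : ℝ := Real.log s - s ^ (-(1 / 4) : ℝ)

/-- The first derivative of `profile`. -/
noncomputable def profileD1 (s : ℝ) : ℝ := (1 + s ^ (-(1 / 4) : ℝ) / 4) / s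

/-- The second derivative of `profile`. -/
noncomputable def profileD2 (s : ℝ) : ℝ := -(1 + 5 * s ^ (-(1 / 4) : ℝ) / 16) / s ^ 2

/-- The third derivative of `profile`. -/
noncomputable def profileD3 (s : ℝ) : ℝ := (2 + 45 * s ^ (-(1 / 4) : ℝ) / 64) / s ^ 3

/-- The two-dimensional Laplacian of `x ↦ profile (|x|²)`. -/
noncomputable def profileLap (s : ℝ) : ℝ := -(s ^ (-(1 / 4) : ℝ) / (4 * s))

/-- The corrected Lyapunov function at a point `x` with direction `y`, in terms of `s = |x|²`
and `u = ⟪x, y⟫`: the profile, plus multiples of its first and second derivative in the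
direction `y` and of its Laplacian. -/
noncomputable def lyapunov (a b g s u : ℝ) : ℝ :=
  profile s + a * (2 * u * profileD1 s) + b * (4 * u ^ 2 * profileD2 s + 2 * profileD1 s)
    + g * profileLap s

theorem hasDerivAt_rpow_neg_quarter {s : ℝ} (hs : 0 < s) :
    HasDerivAt (fun x : ℝ => x ^ (-(1 / 4) : ℝ)) (-(s ^ (-(1 / 4) : ℝ) / (4 * s))) s := by
  have h := Real.hasDerivAt_rpow_const (x := s) (p := (-(1 / 4) : ℝ)) (Or.inl hs.ne')
  convert h using 1
  rw [Real.rpow_sub_one hs.ne']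
  field_simp

theorem hasDerivAt_profile {s : ℝ} (hs : 0 < s) : HasDerivAt profile (profileD1 s) s := by
  have h : HasDerivAt profile _ s :=
    (Real.hasDerivAt_log hs.ne').sub (hasDerivAt_rpow_neg_quarter hs)
  refine h.congr_deriv ?_
  unfold profileD1
  field_simp
  ring

theorem hasDerivAt_profileD1 {s : ℝ} (hs : 0 < s) : HasDerivAt profileD1 (profileD2 s) s := by
  have h : HasDerivAt profileD1 _ s :=
    (((hasDerivAt_rpow_neg_quarter hs).div_const 4).const_add 1).div (hasDerivAt_id s) hs.ne'
  refine h.congr_deriv ?_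
  unfold profileD2
  field_simp
  ring

theorem hasDerivAt_profileD2 {s : ℝ} (hs : 0 < s) : HasDerivAt profileD2 (profileD3 s) s := by
  have h : HasDerivAt profileD2 _ s :=
    ((((hasDerivAt_rpow_neg_quarter hs).const_mul 5).div_const 16).const_add 1).neg.div
      (hasDerivAt_pow 2 s) (by positivity)
  refine h.congr_deriv ?_
  unfold profileD3
  simp only [Pi.neg_apply]
  field_simp
  ring

theorem hasDerivAt_profileLap {s : ℝ} (hs : 0 < s) :
    HasDerivAt profileLap (5 * s ^ (-(1 / 4) : ℝ) / (16 * s ^ 2)) s := by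
  have h : HasDerivAt profileLap _ s :=
    ((hasDerivAt_rpow_neg_quarter hs).div ((hasDerivAt_id s).const_mul 4)
      (by simpa using hs.ne')).neg
  refine h.congr_deriv ?_
  simp only [id]
  field_simp
  ring

/-- The right side is the planar Laplacian of a function of `s = |x|²`. The logarithm is harmonic,
so only the power term survives. -/
theorem profileLap_eq {s : ℝ} (hs : 0 < s) :
    profileLap s = 4 * s * profileD2 s + 4 * profileD1 s := by
  unfold profileLap profileD1 profileD2
  field_simp
  ring

theorem rpow_neg_quarter_mem {s : ℝ} (hs : 1 ≤ s) : s ^ (-(1 / 4) : ℝ) ∈ Set.Icc (0 : ℝ) 1 :=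
  ⟨by positivity, Real.rpow_le_one_of_one_le_of_nonpos hs (by norm_num)⟩

theorem abs_profileD1_le {s : ℝ} (hs : 1 ≤ s) : |profileD1 s| ≤ 2 / s := by
  obtain ⟨h0, h1⟩ := rpow_neg_quarter_mem hs
  rw [profileD1, abs_of_nonneg (by positivity)]
  gcongr
  linarith

theorem abs_profileD2_le {s : ℝ} (hs : 1 ≤ s) : |profileD2 s| ≤ 2 / s ^ 2 := by
  obtain ⟨h0, h1⟩ := rpow_neg_quarter_mem hs
  rw [profileD2, neg_div, abs_neg, abs_of_nonneg (by positivity)]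
  gcongr
  linarith

theorem abs_profileD3_le {s : ℝ} (hs : 1 ≤ s) : |profileD3 s| ≤ 3 / s ^ 3 := by
  obtain ⟨h0, h1⟩ := rpow_neg_quarter_mem hs
  rw [profileD3, abs_of_nonneg (by positivity)]
  gcongr
  linarith

theorem abs_profileLap_le {s : ℝ} (hs : 1 ≤ s) : |profileLap s| ≤ 1 / s := by
  obtain ⟨h0, h1⟩ := rpow_neg_quarter_mem hs
  rw [profileLap, abs_neg, abs_of_nonneg (by positivity), div_le_div_iff₀ (by positivity)
    (by positivity)]
  nlinarith

/-! ### Taylor expansion along a unit step -/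

theorem abs_sub_le_of_deriv_le {f f' : ℝ → ℝ} {M : ℝ}
    (hf : ∀ t ∈ Set.Icc (0 : ℝ) 1, HasDerivAt f (f' t) t)
    (hM : ∀ t ∈ Set.Icc (0 : ℝ) 1, |f' t| ≤ M) {t : ℝ} (ht : t ∈ Set.Icc (0 : ℝ) 1) :
    |f t - f 0| ≤ M := by
  have h := (convex_Icc (0 : ℝ) 1).norm_image_sub_le_of_norm_hasDerivWithin_le
    (fun x hx => (hf x hx).hasDerivWithinAt) hM (Set.left_mem_Icc.2 zero_le_one) ht
  have hM0 : 0 ≤ M := (abs_nonneg _).trans (hM t ht)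
  rw [Real.norm_eq_abs, Real.norm_eq_abs, sub_zero, abs_of_nonneg ht.1] at h
  exact h.trans (mul_le_of_le_one_right hM0 ht.2)

/-- Taylor estimates on `[0, 1]` for a function and its first two derivatives. -/
theorem taylor_bounds {h h1 h2 h3 : ℝ → ℝ} {M : ℝ}
    (d0 : ∀ t ∈ Set.Icc (0 : ℝ) 1, HasDerivAt h (h1 t) t)
    (d1 : ∀ t ∈ Set.Icc (0 : ℝ) 1, HasDerivAt h1 (h2 t) t)
    (d2 : ∀ t ∈ Set.Icc (0 : ℝ) 1, HasDerivAt h2 (h3 t) t)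
    (hM : ∀ t ∈ Set.Icc (0 : ℝ) 1, |h3 t| ≤ M) :
    |h 1 - (h 0 + h1 0 + h2 0 / 2)| ≤ M ∧ |h1 1 - (h1 0 + h2 0)| ≤ M ∧ |h2 1 - h2 0| ≤ M := by
  have one_mem : (1 : ℝ) ∈ Set.Icc (0 : ℝ) 1 := Set.right_mem_Icc.2 zero_le_one
  have e2 : ∀ t ∈ Set.Icc (0 : ℝ) 1, |h2 t - h2 0| ≤ M := fun t ht =>
    abs_sub_le_of_deriv_le d2 hM ht
  have e1 : ∀ t ∈ Set.Icc (0 : ℝ) 1, |h1 t - h1 0 - t * h2 0| ≤ M := fun t ht => by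
    have := abs_sub_le_of_deriv_le (f := fun t => h1 t - t * h2 0)
      (f' := fun t => h2 t - h2 0) (fun x hx =>
        ((d1 x hx).sub ((hasDerivAt_id x).mul_const (h2 0))).congr_deriv (by ring)) e2 ht
    simp only [zero_mul, sub_zero] at this
    rwa [sub_right_comm]
  have e0 := abs_sub_le_of_deriv_le (f := fun t => h t - t * h1 0 - t ^ 2 / 2 * h2 0)
      (f' := fun t => h1 t - h1 0 - t * h2 0) (fun x hx =>
        (((d0 x hx).sub ((hasDerivAt_id x).mul_const (h1 0))).sub
          (((hasDerivAt_pow 2 x).div_const 2).mul_const (h2 0))).congr_deriv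
          (by push_cast; ring)) e1 one_mem
  refine ⟨?_, ?_, e2 1 one_mem⟩
  · convert e0 using 2
    ring
  · convert e1 1 one_mem using 2
    ring

/-- With `s = |x|²` and `u = ⟪x, y⟫`, the right side is `|x + t y|²`, and `|x + t y| ≥ |x| - 1 ≥ |x|
/ 2` once `|x| ≥ 2`. -/
theorem quarter_le_shift {s u t : ℝ} (hs : 4 ≤ s) (hu : u ^ 2 ≤ s)
    (ht : t ∈ Set.Icc (0 : ℝ) 1) : s / 4 ≤ s + 2 * u * t + t ^ 2 := by
  nlinarith [sq_nonneg (u + 2 * t), ht.1, ht.2]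

/-- Cauchy–Schwarz bounds `|⟪x + t y, y⟫|` by `|x + t y|`, leaving `|x + t y|⁻³`, which is
comparable to `|x|⁻³`. This is the order of every Taylor error below. -/
theorem abs_mul_inv_sq_le {s u t : ℝ} (hs : 4 ≤ s) (hu : u ^ 2 ≤ s)
    (ht : t ∈ Set.Icc (0 : ℝ) 1) :
    |u + t| / (s + 2 * u * t + t ^ 2) ^ 2 ≤ 8 / (s * √s) := by
  have h4 := quarter_le_shift hs hu ht
  set σ := s + 2 * u * t + t ^ 2 with hσ
  have hσ0 : 0 < σ := by linarith
  have hv : |u + t| ≤ √σ := Real.abs_le_sqrt (by rw [hσ]; nlinarith)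
  have hr : √s / 2 ≤ √σ := by
    apply Real.le_sqrt_of_sq_le
    rw [div_pow, Real.sq_sqrt (by linarith)]
    linarith
  have hs0 : 0 < √s := Real.sqrt_pos.2 (by linarith)
  have hσr : 0 < √σ := Real.sqrt_pos.2 hσ0
  calc |u + t| / σ ^ 2 ≤ √σ / σ ^ 2 := by gcongr
    _ = 1 / (σ * √σ) := by
        rw [div_eq_div_iff (by positivity) (by positivity)]
        nlinarith [Real.mul_self_sqrt hσ0.le]
    _ ≤ 1 / ((s / 4) * (√s / 2)) := by
        apply one_div_le_one_div_of_le (by positivity)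
        gcongr
    _ = 8 / (s * √s) := by field_simp; norm_num

theorem hasDerivAt_shift (s u t : ℝ) :
    HasDerivAt (fun t : ℝ => s + 2 * u * t + t ^ 2) (2 * (u + t)) t := by
  refine ((((hasDerivAt_id t).const_mul (2 * u)).const_add s).add
    (hasDerivAt_pow 2 t)).congr_deriv ?_
  push_cast
  ring

/-- Expansion of the profile, its derivatives and its Laplacian along a unit step. -/
theorem profile_step {s u : ℝ} (hs : 4 ≤ s) (hu : u ^ 2 ≤ s) :
    |profile (s + 2 * u + 1) - (profile s + 2 * u * profileD1 s
      + (4 * u ^ 2 * profileD2 s + 2 * profileD1 s) / 2)| ≤ 384 / (s * √s) ∧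
    |2 * (u + 1) * profileD1 (s + 2 * u + 1) - (2 * u * profileD1 s
      + (4 * u ^ 2 * profileD2 s + 2 * profileD1 s))| ≤ 384 / (s * √s) ∧
    |(4 * (u + 1) ^ 2 * profileD2 (s + 2 * u + 1) + 2 * profileD1 (s + 2 * u + 1))
      - (4 * u ^ 2 * profileD2 s + 2 * profileD1 s)| ≤ 384 / (s * √s) ∧
    |profileLap (s + 2 * u + 1) - profileLap s| ≤ 384 / (s * √s) := by
  have pos : ∀ t ∈ Set.Icc (0 : ℝ) 1, 1 ≤ s + 2 * u * t + t ^ 2 := fun t ht => by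
    linarith [quarter_le_shift hs hu ht]
  have hlin : ∀ t : ℝ, HasDerivAt (fun t : ℝ => 2 * (u + t)) 2 t := fun t => by
    simpa using ((hasDerivAt_id t).const_add u).const_mul 2
  -- These are the successive derivatives of `f` along the segment `t ↦ x + t y`.
  have key := taylor_bounds (h := fun t => profile (s + 2 * u * t + t ^ 2))
    (h1 := fun t => 2 * (u + t) * profileD1 (s + 2 * u * t + t ^ 2))
    (h2 := fun t => 4 * (u + t) ^ 2 * profileD2 (s + 2 * u * t + t ^ 2)
      + 2 * profileD1 (s + 2 * u * t + t ^ 2))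
    (h3 := fun t => 8 * (u + t) ^ 3 * profileD3 (s + 2 * u * t + t ^ 2)
      + 12 * (u + t) * profileD2 (s + 2 * u * t + t ^ 2))
    (M := 384 / (s * √s)) ?_ ?_ ?_ ?_
  · have lap := abs_sub_le_of_deriv_le (f := fun t => profileLap (s + 2 * u * t + t ^ 2))
      (f' := fun t => 5 * (s + 2 * u * t + t ^ 2) ^ (-(1 / 4) : ℝ)
        / (16 * (s + 2 * u * t + t ^ 2) ^ 2) * (2 * (u + t)))
      (M := 384 / (s * √s)) (fun t ht =>
        (hasDerivAt_profileLap (by linarith [pos t ht])).comp t (hasDerivAt_shift s u t))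
      (fun t ht => by
        obtain ⟨h0, h1⟩ := rpow_neg_quarter_mem (pos t ht)
        have hb := abs_mul_inv_sq_le hs hu ht
        have hp := pos t ht
        set σ := s + 2 * u * t + t ^ 2
        set w := σ ^ (-(1 / 4) : ℝ)
        rw [show 5 * w / (16 * σ ^ 2) * (2 * (u + t)) = (5 * w / 8) * ((u + t) / σ ^ 2) by
          field_simp; ring, abs_mul, abs_div (u + t), abs_of_nonneg (by positivity),
          abs_of_nonneg (by positivity : (0 : ℝ) ≤ σ ^ 2)]
        calc (5 * w / 8) * (|u + t| / σ ^ 2) ≤ 1 * (8 / (s * √s)) := by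
              gcongr
              linarith
          _ ≤ 384 / (s * √s) := by rw [one_mul]; gcongr; norm_num)
      (Set.right_mem_Icc.2 zero_le_one)
    simp only [mul_one, one_pow, add_zero, mul_zero, ne_eq, OfNat.ofNat_ne_zero,
      not_false_eq_true, zero_pow] at key lap
    exact ⟨key.1, key.2.1, key.2.2, lap⟩
  · intro t ht
    refine ((hasDerivAt_profile (by linarith [pos t ht])).comp t
      (hasDerivAt_shift s u t)).congr_deriv ?_
    ring
  · intro t ht
    refine ((hlin t).mul ((hasDerivAt_profileD1 (by linarith [pos t ht])).comp t
      (hasDerivAt_shift s u t))).congr_deriv ?_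
    simp only [Function.comp]
    ring
  · intro t ht
    have h0 : 0 < s + 2 * u * t + t ^ 2 := by linarith [pos t ht]
    have hsq : HasDerivAt (fun t : ℝ => 4 * (u + t) ^ 2) (8 * (u + t)) t :=
      ((((hasDerivAt_id t).const_add u).pow 2).const_mul 4).congr_deriv (by simp; ring)
    refine ((hsq.mul
      ((hasDerivAt_profileD2 h0).comp t (hasDerivAt_shift s u t))).add
      (((hasDerivAt_profileD1 h0).comp t (hasDerivAt_shift s u t)).const_mul 2)).congr_deriv ?_
    simp only [Function.comp]
    ring
  · intro t ht
    have hb := abs_mul_inv_sq_le hs hu ht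
    have hp := pos t ht
    have h3 := abs_profileD3_le hp
    have h2 := abs_profileD2_le hp
    have hv : (u + t) ^ 2 ≤ s + 2 * u * t + t ^ 2 := by nlinarith
    set σ := s + 2 * u * t + t ^ 2
    have hσ : 0 < σ := by linarith
    calc |8 * (u + t) ^ 3 * profileD3 σ + 12 * (u + t) * profileD2 σ|
        ≤ 8 * (|u + t| * (u + t) ^ 2) * |profileD3 σ| + 12 * |u + t| * |profileD2 σ| := by
          refine (abs_add_le _ _).trans (le_of_eq ?_)
          simp only [abs_mul, abs_pow, Nat.abs_ofNat]
          rw [← sq_abs (u + t)]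
          ring
      _ ≤ 8 * (|u + t| * σ) * (3 / σ ^ 3) + 12 * |u + t| * (2 / σ ^ 2) := by gcongr
      -- `48 = 8 · 3 + 12 · 2`; the bound `8 / (s * √s)` then gives `384 = 48 · 8`.
      _ = 48 * (|u + t| / σ ^ 2) := by field_simp; norm_num
      _ ≤ 48 * (8 / (s * √s)) := by gcongr
      _ = 384 / (s * √s) := by ring

/-! ### One-step and lower bounds for the corrected function -/

/-- The leading part of the Lyapunov function after a unit step in a direction `y`, in terms of
`s = |x|²` and `u = ⟪x, y⟫` before the step. -/
noncomputable def lyapunovStep (a b g s u : ℝ) : ℝ :=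
  profile s + (1 + a) * (2 * u * profileD1 s)
    + (1 / 2 + a + b) * (4 * u ^ 2 * profileD2 s + 2 * profileD1 s) + g * profileLap s

theorem lyapunov_step_le {a b g s u B : ℝ} (ha : |a| ≤ B) (hb : |b| ≤ B) (hg : |g| ≤ B)
    (hs : 4 ≤ s) (hu : u ^ 2 ≤ s) :
    lyapunov a b g (s + 2 * u + 1) (u + 1)
      ≤ lyapunovStep a b g s u + (1 + 3 * B) * (384 / (s * √s)) := by
  obtain ⟨h0, h1, h2, h3⟩ := profile_step hs hu
  have hB : 0 ≤ B := (abs_nonneg _).trans ha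
  have mul_le : ∀ c x : ℝ, |c| ≤ B → |x| ≤ 384 / (s * √s) → c * x ≤ B * (384 / (s * √s)) :=
    fun c x hc hx => (le_abs_self _).trans (by rw [abs_mul]; gcongr)
  have e0 := (le_abs_self _).trans h0
  have e1 := mul_le _ _ ha h1
  have e2 := mul_le _ _ hb h2
  have e3 := mul_le _ _ hg h3
  unfold lyapunov lyapunovStep
  linarith

/-- The corrections stay bounded, so growth is logarithmic uniformly in the coefficients: `1` bounds
`s^(-1/4)`, and `17 = 4 + 12 + 1` collects the bounds on the first derivative, second derivative and
Laplacian. -/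
theorem lyapunov_ge {a b g s u B : ℝ} (ha : |a| ≤ B) (hb : |b| ≤ B) (hg : |g| ≤ B)
    (hs : 1 ≤ s) (hu : u ^ 2 ≤ s) :
    Real.log s - (1 + 17 * B) ≤ lyapunov a b g s u := by
  have hB : 0 ≤ B := (abs_nonneg _).trans ha
  have h1 := abs_profileD1_le hs
  have h2 := abs_profileD2_le hs
  have hl := abs_profileLap_le hs
  have h1s : |profileD1 s| ≤ 2 := h1.trans ((div_le_iff₀ (by linarith)).2 (by linarith))
  have hls : |profileLap s| ≤ 1 := hl.trans ((div_le_iff₀ (by linarith)).2 (by linarith))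
  have hus : |u| ≤ s := abs_le_of_sq_le_sq (by nlinarith) (by linarith)
  have k1 : |2 * u * profileD1 s| ≤ 4 := by
    rw [abs_mul, abs_mul, abs_two]
    calc 2 * |u| * |profileD1 s| ≤ 2 * s * (2 / s) := by gcongr
      _ = 4 := by field_simp; norm_num
  have k2 : |4 * u ^ 2 * profileD2 s + 2 * profileD1 s| ≤ 12 := by
    refine (abs_add_le _ _).trans ?_
    rw [abs_mul, abs_mul 2, abs_two, abs_of_nonneg (by positivity : 0 ≤ 4 * u ^ 2)]
    have : 4 * u ^ 2 * |profileD2 s| ≤ 8 :=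
      calc 4 * u ^ 2 * |profileD2 s| ≤ 4 * s * (2 / s ^ 2) := by gcongr
        _ = 8 / s := by field_simp; norm_num
        _ ≤ 8 := (div_le_iff₀ (by linarith)).2 (by linarith)
    linarith
  have mul_ge : ∀ c x K : ℝ, |c| ≤ B → |x| ≤ K → -(B * K) ≤ c * x :=
    fun c x K hc hx => by
      have : |c * x| ≤ B * K := by rw [abs_mul]; gcongr
      linarith [neg_abs_le (c * x)]
  have e1 := mul_ge _ _ _ ha k1
  have e2 := mul_ge _ _ _ hb k2
  have e3 := mul_ge _ _ _ hg hls
  have e0 := (rpow_neg_quarter_mem hs).2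
  unfold lyapunov profile
  linarith

/-- The Laplacian has order `s^(-5/4)` and the Taylor error `s^(-3/2)`, so the negative term wins
for large `s`. -/
theorem eventually_drift_nonpos {κ : ℝ} (hκ : 0 < κ) (C : ℝ) :
    ∀ᶠ s : ℝ in atTop, κ * profileLap s + C * (384 / (s * √s)) ≤ 0 := by
  have h := (tendsto_rpow_atTop (by norm_num : (0 : ℝ) < 1 / 4)).eventually_ge_atTop
    (4 * C * 384 / κ)
  filter_upwards [h, eventually_gt_atTop 0] with s hs hs0
  have hr : s ^ (-(1 / 4) : ℝ) * √s = s ^ ((1 / 4) : ℝ) := by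
    rw [Real.sqrt_eq_rpow, ← Real.rpow_add hs0]
    norm_num
  have hq : 0 < √s := Real.sqrt_pos.2 hs0
  rw [div_le_iff₀ hκ, ← hr] at hs
  have : κ * profileLap s + C * (384 / (s * √s))
      = (4 * C * 384 - s ^ (-(1 / 4) : ℝ) * √s * κ) / (4 * s * √s) := by
    unfold profileLap
    field_simp
    ring
  rw [this]
  exact div_nonpos_of_nonpos_of_nonneg (by linarith) (by positivity)


/-! ### Periodic recursions for the coefficients -/

theorem prod_range_periodic {q : ℕ → ℝ} {r : ℕ} (hq : ∀ n, q (n + r) = q n) (n : ℕ) :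
    ∏ j ∈ Finset.range r, q (n + j) = ∏ j ∈ Finset.range r, q j := by
  induction n with
  | zero => simp
  | succ n ih =>
    rw [← ih]
    cases r with
    | zero => simp
    | succ r =>
      rw [Finset.prod_range_succ, Finset.prod_range_succ']
      rw [show n + 1 + r = n + (r + 1) by ring, hq, add_zero]
      congr 1
      exact Finset.prod_congr rfl fun j _ => by congr 1; ring

/-- A periodic affine recursion that contracts over a period has a periodic solution. -/
theorem exists_periodic_solution {q w : ℕ → ℝ} {r : ℕ} (hq : ∀ n, q (n + r) = q n)
    (hw : ∀ n, w (n + r) = w n) (hq0 : ∀ n, 0 ≤ q n) (hw0 : ∀ n, 0 ≤ w n)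
    (hlt : ∏ j ∈ Finset.range r, q j < 1) :
    ∃ a : ℕ → ℝ, (∀ n, 0 ≤ a n) ∧ (∀ n, a (n + r) = a n) ∧
      ∀ n, a n = q n * (w n + a (n + 1)) := by
  set β := ∏ j ∈ Finset.range r, q j with hβ
  have hβ1 : 0 < 1 - β := by linarith
  -- Unrolling the recursion gives the series of all `c n k`. Shifting `k` by a period multiplies
  -- the term by `β`, so the series is its first block divided by `1 - β`.
  set c : ℕ → ℕ → ℝ := fun n k => (∏ j ∈ Finset.range (k + 1), q (n + j)) * w (n + k) with hc
  refine ⟨fun n => (∑ k ∈ Finset.range r, c n k) / (1 - β), fun n => ?_, fun n => ?_,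
    fun n => ?_⟩
  · exact div_nonneg (Finset.sum_nonneg fun k _ =>
      mul_nonneg (Finset.prod_nonneg fun j _ => hq0 _) (hw0 _)) hβ1.le
  · simp only [hc, add_right_comm n r, hq, hw]
  · have h1 : ∀ k, q n * c (n + 1) k = c n (k + 1) := fun k => by
      simp only [hc]
      rw [Finset.prod_range_succ' _ (k + 1), add_zero, ← mul_assoc, mul_comm (q n)]
      congr 2
      · exact Finset.prod_congr rfl fun j _ => by congr 1; ring
      · ring
    have h2 : c n r = β * (q n * w n) := by
      simp only [hc]
      rw [Finset.prod_range_succ, prod_range_periodic hq, hq, hw, mul_assoc]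
    have h3 : c n 0 = q n * w n := by simp [hc]
    have h4 : q n * ∑ k ∈ Finset.range r, c (n + 1) k
        = ∑ k ∈ Finset.range r, c n k + c n r - c n 0 := by
      rw [Finset.mul_sum, ← Finset.sum_range_succ, Finset.sum_range_succ']
      simp [h1]
    rw [mul_add, ← mul_div_assoc, h4, h2, h3]
    field_simp
    ring

theorem exists_abs_le_of_periodic {a : ℕ → ℝ} {r : ℕ} (hr : 1 ≤ r)
    (ha : ∀ n, a (n + r) = a n) : ∃ B, ∀ n, |a n| ≤ B := by
  refine ⟨∑ k ∈ Finset.range r, |a k|, fun n => ?_⟩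
  have h : a (n % r) = a n := Function.Periodic.map_mod_nat (f := a) ha n
  rw [← h]
  exact Finset.single_le_sum (f := fun k => |a k|) (fun _ _ => abs_nonneg _)
    (Finset.mem_range.2 (Nat.mod_lt _ hr))

/-- The coefficients of the Lyapunov function, for a periodic sequence of refreshment
probabilities that is not identically zero. -/
theorem exists_coefficients {q : ℕ → ℝ} {r : ℕ} (hr : 1 ≤ r) (hq : ∀ n, q (n + r) = q n)
    (hmem : ∀ n, q n ∈ Set.Icc (0 : ℝ) 1) (hpos : ∃ n, 0 < q n) :
    ∃ (a b g : ℕ → ℝ) (κ B : ℝ), 0 < κ ∧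
      (∀ n, |a n| ≤ B) ∧ (∀ n, |b n| ≤ B) ∧ (∀ n, |g n| ≤ B) ∧
      (∀ n, a n = (1 - q n) * (1 + a (n + 1))) ∧
      (∀ n, b n = (1 - q n) * (1 / 2 + a (n + 1) + b (n + 1))) ∧
      (∀ n, g n = g (n + 1) + q n / 2 * (1 / 2 + a (n + 1) + b (n + 1)) - κ) := by
  obtain ⟨m, hm⟩ := hpos
  have hm' : 0 < q (m % r) := by rwa [Function.Periodic.map_mod_nat (f := q) hq m]
  have hmr : m % r ∈ Finset.range r := Finset.mem_range.2 (Nat.mod_lt _ hr)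
  have hlt : ∏ j ∈ Finset.range r, (1 - q j) < 1 := by
    rw [← Finset.mul_prod_erase _ _ hmr]
    have h1 : ∏ j ∈ (Finset.range r).erase (m % r), (1 - q j) ≤ 1 :=
      Finset.prod_le_one (fun j _ => by linarith [(hmem j).2]) fun j _ => by linarith [(hmem j).1]
    have h0 : 0 ≤ 1 - q (m % r) := by linarith [(hmem (m % r)).2]
    nlinarith
  have hq1 : ∀ n, 1 - q (n + r) = 1 - q n := fun n => by rw [hq]
  have h0 : ∀ n, 0 ≤ 1 - q n := fun n => by linarith [(hmem n).2]
  obtain ⟨a, ha0, ha, hae⟩ := exists_periodic_solution (q := fun n => 1 - q n)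
    (w := fun _ => 1) hq1 (fun _ => rfl) h0 (fun _ => zero_le_one) hlt
  obtain ⟨b, hb0, hb, hbe⟩ := exists_periodic_solution (q := fun n => 1 - q n)
    (w := fun n => 1 / 2 + a (n + 1)) hq1 (fun n => by rw [add_right_comm, ha]) h0
    (fun n => by linarith [ha0 (n + 1)]) hlt
  set v : ℕ → ℝ := fun n => q n / 2 * (1 / 2 + a (n + 1) + b (n + 1)) with hv
  have hvp : ∀ n, v (n + r) = v n := fun n => by
    simp only [hv, hq, add_right_comm n r 1, ha, hb]
  have hv0 : ∀ n, 0 ≤ v n := fun n =>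
    mul_nonneg (by linarith [(hmem n).1]) (by linarith [ha0 (n + 1), hb0 (n + 1)])
  have hr0 : (0 : ℝ) < r := by exact_mod_cast hr
  set κ : ℝ := (∑ k ∈ Finset.range r, v k) / r with hκ
  have hκ0 : 0 < κ := by
    refine div_pos (Finset.sum_pos' (fun k _ => hv0 k) ⟨m % r, hmr, ?_⟩) hr0
    exact mul_pos (by linarith) (by linarith [ha0 (m % r + 1), hb0 (m % r + 1)])
  -- These are the partial sums of `κ - v`. Since `κ` is the mean of `v` over a period, `g` is
  -- periodic and therefore bounded.
  set g : ℕ → ℝ := fun n => n * κ - ∑ k ∈ Finset.range n, v k with hg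
  have hge : ∀ n, g n = g (n + 1) + v n - κ := fun n => by
    simp only [hg, Finset.sum_range_succ]
    push_cast
    ring
  have hgp : ∀ n, g (n + r) = g n := fun n => by
    induction n with
    | zero =>
      simp only [hg, hκ, zero_add]
      field_simp
      simp
    | succ n ih =>
      have e1 := hge n
      have e2 := hge (n + r)
      rw [hvp, ih, add_right_comm n r 1] at e2
      linarith
  obtain ⟨A, hA⟩ := exists_abs_le_of_periodic hr ha
  obtain ⟨B, hB⟩ := exists_abs_le_of_periodic hr hb
  obtain ⟨G, hG⟩ := exists_abs_le_of_periodic hr hgp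
  refine ⟨a, b, g, κ, max A (max B G), hκ0, fun n => (hA n).trans (le_max_left _ _),
    fun n => (hB n).trans ((le_max_left _ _).trans (le_max_right _ _)),
    fun n => (hG n).trans ((le_max_right _ _).trans (le_max_right _ _)), hae, hbe, hge⟩

/-! ### Functionals of finite trajectories and the Markov property -/

open scoped ENNReal

section Chain

variable {Ω : Type*} {d : ℕ} {Y : ℕ → Ω → Direction d}

/-- The first `n` directions of the chain. -/
def initialSegment (Y : ℕ → Ω → Direction d) (n : ℕ) (ω : Ω) : Finset.Icc 1 n → Direction d :=
  fun k => Y k ω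

/-- A trajectory with a given initial segment. -/
def extend [NeZero d] {n : ℕ} (t : Finset.Icc 1 n → Direction d) (k : ℕ) : Direction d :=
  if h : k ∈ Finset.Icc 1 n then t ⟨k, h⟩ else (0, true)

theorem extend_of_mem [NeZero d] {n k : ℕ} (t : Finset.Icc 1 n → Direction d)
    (hk : k ∈ Finset.Icc 1 n) : extend t k = t ⟨k, hk⟩ := dif_pos hk

/-- `G` depends on the coordinates `1, …, n` only. -/
def DependsOnFirst {α : Type*} (n : ℕ) (G : (ℕ → Direction d) → α) : Prop :=
  ∀ y y' : ℕ → Direction d, (∀ k ∈ Finset.Icc 1 n, y k = y' k) → G y = G y'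

theorem DependsOnFirst.eq_extend [NeZero d] {α : Type*} {n : ℕ} {G : (ℕ → Direction d) → α}
    (hG : DependsOnFirst n G) (ω : Ω) :
    G (fun k => Y k ω) = G (extend (initialSegment Y n ω)) :=
  hG _ _ fun k hk => by rw [extend_of_mem _ hk, initialSegment]

variable [MeasurableSpace Ω] {P : Measure Ω} {p : ℕ → ℝ}

theorem IsDirectionChain.measurable_initialSegment (hY : IsDirectionChain P d p Y) (n : ℕ) :
    Measurable (initialSegment Y n) :=
  measurable_pi_lambda _ fun k => hY.measurable k (Finset.mem_Icc.1 k.2).1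

theorem IsDirectionChain.measurable_of_dependsOnFirst [NeZero d] {α : Type*} [MeasurableSpace α]
    (hY : IsDirectionChain P d p Y) {n : ℕ} {G : (ℕ → Direction d) → α}
    (hG : DependsOnFirst n G) : Measurable fun ω => G fun k => Y k ω := by
  simp_rw [hG.eq_extend]
  exact (Measurable.of_discrete (f := fun t => G (extend t))).comp
    (hY.measurable_initialSegment n)

/-- Only finitely many initial segments exist, so the sum of `G` over all of them is a finite
uniform bound. -/
theorem lintegral_ne_top_of_dependsOnFirst [NeZero d] [IsFiniteMeasure P] {n : ℕ}
    {G : (ℕ → Direction d) → ℝ≥0∞} (hG : DependsOnFirst n G) (hfin : ∀ y, G y ≠ ∞) :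
    ∫⁻ ω, G (fun k => Y k ω) ∂P ≠ ∞ := by
  simp_rw [hG.eq_extend]
  refine ne_top_of_le_ne_top ?_ (lintegral_mono fun ω => Finset.single_le_sum
    (f := fun t : Finset.Icc 1 n → Direction d => G (extend t)) (fun _ _ => zero_le)
    (Finset.mem_univ (initialSegment Y n ω)))
  rw [lintegral_const]
  exact ENNReal.mul_ne_top (ENNReal.sum_ne_top.2 fun t _ => hfin _) (measure_ne_top _ _)

theorem stepMatrix_apply (d : ℕ) (q : ℝ) (a b : Direction d) :
    stepMatrix d q a b = (1 - q) * (if a = b then 1 else 0) + q / (2 * d) := by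
  simp [stepMatrix, Matrix.one_apply]

theorem stepMatrix_nonneg {q : ℝ} (hq : q ∈ Set.Icc (0 : ℝ) 1) (a b : Direction d) :
    0 ≤ stepMatrix d q a b := by
  rw [stepMatrix_apply]
  have h0 := hq.1
  have h1 : 0 ≤ 1 - q := by linarith [hq.2]
  positivity

/-- The Markov property in terms of expectations. -/
theorem IsDirectionChain.lintegral_step [NeZero d] [IsFiniteMeasure P]
    (hY : IsDirectionChain P d p Y) {n : ℕ} (hn : 1 ≤ n)
    {G : (ℕ → Direction d) → Direction d → ℝ≥0∞} (hG : DependsOnFirst n G) :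
    ∫⁻ ω, G (fun k => Y k ω) (Y (n + 1) ω) ∂P =
      ∫⁻ ω, ∑ b, ENNReal.ofReal (stepMatrix d (p n) (Y n ω) b) * G (fun k => Y k ω) b ∂P := by
  have hT := hY.measurable_initialSegment n
  have hn' : n ∈ Finset.Icc 1 n := Finset.mem_Icc.2 ⟨hn, le_rfl⟩
  have hTY := hT.prodMk (hY.measurable (n + 1) (by omega))
  have hl := lintegral_map (μ := P) (f := fun z : (Finset.Icc 1 n → Direction d) × Direction d =>
    G (extend z.1) z.2) Measurable.of_discrete hTY
  have hr := lintegral_map (μ := P) (f := fun t : Finset.Icc 1 n → Direction d =>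
    ∑ b, ENNReal.ofReal (stepMatrix d (p n) (t ⟨n, hn'⟩) b) * G (extend t) b)
    Measurable.of_discrete hT
  simp_rw [hG.eq_extend]
  refine hl.symm.trans (Eq.trans ?_ hr)
  rw [lintegral_fintype, lintegral_fintype, Fintype.sum_prod_type]
  refine Finset.sum_congr rfl fun t _ => ?_
  rw [Finset.sum_mul]
  refine Finset.sum_congr rfl fun b _ => ?_
  rw [Measure.map_apply hTY (measurableSet_singleton _),
    Measure.map_apply hT (measurableSet_singleton _)]
  -- Appending `b` to the segment `t` makes the two cylinder events of the Markov property the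
  -- fibres over `(t, b)` and `t`.
  have h := hY.markov n hn (Function.update (extend t) (n + 1) b)
  have e1 : {ω | ∀ k ∈ Finset.Icc 1 (n + 1), Y k ω = Function.update (extend t) (n + 1) b k}
      = (fun ω => (initialSegment Y n ω, Y (n + 1) ω)) ⁻¹' {(t, b)} := by
    ext ω
    simp only [Set.mem_ofPred_eq, Set.mem_preimage, Set.mem_singleton_iff, Prod.mk.injEq]
    constructor
    · intro H
      refine ⟨funext fun k => ?_, by simpa using H (n + 1) (by simp)⟩
      have hk := Finset.mem_Icc.1 k.2
      rw [initialSegment, H k (Finset.mem_Icc.2 ⟨hk.1, by omega⟩),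
        Function.update_of_ne (by omega), extend_of_mem _ k.2]
    · rintro ⟨rfl, rfl⟩ k hk
      by_cases hk' : k = n + 1
      · subst hk'
        simp
      · have : k ∈ Finset.Icc 1 n := by
          rw [Finset.mem_Icc] at hk ⊢
          omega
        rw [Function.update_of_ne hk', extend_of_mem _ this, initialSegment]
  have e2 : {ω | ∀ k ∈ Finset.Icc 1 n, Y k ω = Function.update (extend t) (n + 1) b k}
      = initialSegment Y n ⁻¹' {t} := by
    ext ω
    simp only [Set.mem_ofPred_eq, Set.mem_preimage, Set.mem_singleton_iff]
    have hne : ∀ k ∈ Finset.Icc 1 n, k ≠ n + 1 := fun k hk => by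
      rw [Finset.mem_Icc] at hk
      omega
    constructor
    · intro H
      refine funext fun k => ?_
      rw [initialSegment, H k k.2, Function.update_of_ne (hne k k.2), extend_of_mem _ k.2]
    · rintro rfl k hk
      rw [Function.update_of_ne (hne k hk), extend_of_mem _ hk, initialSegment]
  rw [e1, e2, Function.update_self, Function.update_of_ne (by omega), extend_of_mem _ hn'] at h
  rw [← ofReal_measureReal, h, ENNReal.ofReal_mul measureReal_nonneg, ofReal_measureReal]
  ring

end Chain

/-! ### Drift outside a large ball -/

/-- The squared Euclidean norm of a point of `ℤ²`. -/
def normSq (x : Fin 2 → ℤ) : ℝ := (x 0 : ℝ) ^ 2 + (x 1 : ℝ) ^ 2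

/-- The inner product of a point of `ℤ²` with a unit vector. -/
def dirInner (x : Fin 2 → ℤ) (a : Direction 2) : ℝ := if a.2 then (x a.1 : ℝ) else -(x a.1 : ℝ)

theorem dirInner_sq_le (x : Fin 2 → ℤ) (a : Direction 2) : dirInner x a ^ 2 ≤ normSq x := by
  obtain ⟨i, _ | _⟩ := a <;> fin_cases i <;> simp [dirInner, normSq] <;> positivity

theorem dirInner_add_unitVec (x : Fin 2 → ℤ) (a : Direction 2) :
    dirInner (x + unitVec a) a = dirInner x a + 1 := by
  obtain ⟨i, _ | _⟩ := a <;> simp [dirInner, unitVec]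
  ring

theorem normSq_add_unitVec (x : Fin 2 → ℤ) (a : Direction 2) :
    normSq (x + unitVec a) = normSq x + 2 * dirInner x a + 1 := by
  obtain ⟨i, _ | _⟩ := a <;> fin_cases i <;> simp [dirInner, unitVec, normSq] <;> ring

theorem euclNorm_sq (x : Fin 2 → ℤ) : euclNorm x ^ 2 = normSq x := by
  simp [euclNorm, EuclideanSpace.norm_sq_eq, normSq]

theorem sum_stepMatrix_mul (q : ℝ) (a : Direction 2) (f : Direction 2 → ℝ) :
    ∑ b, stepMatrix 2 q a b * f b = (1 - q) * f a + q / 4 * ∑ b, f b := by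
  simp only [stepMatrix_apply, add_mul, Finset.sum_add_distrib, mul_assoc, ← Finset.mul_sum]
  simp
  norm_num

/-- One step of the chain changes the expectation of the Lyapunov function by `κ` times the
Laplacian, up to the Taylor error. -/
theorem sum_stepMatrix_mul_lyapunovStep {q a a' b b' g g' κ s : ℝ} (x : Fin 2 → ℤ)
    (y : Direction 2) (hs : s = normSq x) (hs0 : 0 < s) (ha : a = (1 - q) * (1 + a'))
    (hb : b = (1 - q) * (1 / 2 + a' + b')) (hg : g = g' + q / 2 * (1 / 2 + a' + b') - κ) :
    ∑ z, stepMatrix 2 q y z * lyapunovStep a' b' g' s (dirInner x z) =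
      lyapunov a b g s (dirInner x y) + κ * profileLap s := by
  have hsum : ∑ z, lyapunovStep a' b' g' s (dirInner x z) = 4 * profile s
      + (1 / 2 + a' + b') * (8 * s * profileD2 s + 8 * profileD1 s) + 4 * g' * profileLap s := by
    simp only [Fintype.sum_prod_type, Fin.sum_univ_two, Fintype.sum_bool, dirInner, lyapunovStep,
      hs, normSq]
    simp
    ring
  rw [sum_stepMatrix_mul, hsum, lyapunov, lyapunovStep, profileLap_eq hs0, ha, hb, hg]
  ring

/-- Outside a large ball the Lyapunov function is nonnegative after one step, and its expectation
does not increase. -/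
theorem exists_drift {q a b g : ℕ → ℝ} {κ B : ℝ} (hq : ∀ n, q n ∈ Set.Icc (0 : ℝ) 1) (hκ : 0 < κ)
    (hA : ∀ n, |a n| ≤ B) (hB : ∀ n, |b n| ≤ B) (hG : ∀ n, |g n| ≤ B)
    (ha : ∀ n, a n = (1 - q n) * (1 + a (n + 1)))
    (hb : ∀ n, b n = (1 - q n) * (1 / 2 + a (n + 1) + b (n + 1)))
    (hg : ∀ n, g n = g (n + 1) + q n / 2 * (1 / 2 + a (n + 1) + b (n + 1)) - κ) :
    ∃ R : ℝ, ∀ (n : ℕ) (x : Fin 2 → ℤ) (y : Direction 2), R ≤ normSq x →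
      (∀ z, 0 ≤ lyapunov (a (n + 1)) (b (n + 1)) (g (n + 1)) (normSq (x + unitVec z))
        (dirInner (x + unitVec z) z)) ∧
      ∑ z, stepMatrix 2 (q n) y z * lyapunov (a (n + 1)) (b (n + 1)) (g (n + 1))
        (normSq (x + unitVec z)) (dirInner (x + unitVec z) z)
        ≤ lyapunov (a n) (b n) (g n) (normSq x) (dirInner x y) := by
  obtain ⟨R, hR⟩ := eventually_atTop.1 (eventually_drift_nonpos hκ (1 + 3 * B))
  -- The three thresholds serve the drift, the Taylor estimates, and positivity: a step at most
  -- quarters `s`, so afterwards `log s ≥ 1 + 17 * B`.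
  refine ⟨max R (max 4 (4 * Real.exp (1 + 17 * B))), fun n x y hx => ?_⟩
  obtain ⟨h1, h2, h3⟩ : R ≤ normSq x ∧ 4 ≤ normSq x ∧ 4 * Real.exp (1 + 17 * B) ≤ normSq x := by
    simpa using hx
  constructor
  · intro z
    have hsh := quarter_le_shift h2 (dirInner_sq_le x z) (Set.right_mem_Icc.2 zero_le_one)
    rw [mul_one, one_pow, ← normSq_add_unitVec] at hsh
    refine le_trans ?_ (lyapunov_ge (hA _) (hB _) (hG _) (by linarith) (dirInner_sq_le _ _))
    rw [sub_nonneg, Real.le_log_iff_exp_le (by linarith)]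
    linarith
  · have hrow : ∑ z, stepMatrix 2 (q n) y z = 1 := by
      have := sum_stepMatrix_mul (q n) y fun _ => 1
      simpa using this
    calc _ ≤ ∑ z, stepMatrix 2 (q n) y z * (lyapunovStep (a (n + 1)) (b (n + 1)) (g (n + 1))
          (normSq x) (dirInner x z) + (1 + 3 * B) * (384 / (normSq x * √(normSq x)))) := by
          refine Finset.sum_le_sum fun z _ => mul_le_mul_of_nonneg_left ?_
            (stepMatrix_nonneg (hq n) y z)
          rw [normSq_add_unitVec, dirInner_add_unitVec]
          exact lyapunov_step_le (hA _) (hB _) (hG _) h2 (dirInner_sq_le x z)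
      _ = lyapunov (a n) (b n) (g n) (normSq x) (dirInner x y) + (κ * profileLap (normSq x)
          + (1 + 3 * B) * (384 / (normSq x * √(normSq x)))) := by
          simp only [mul_add, Finset.sum_add_distrib, ← Finset.sum_mul, hrow]
          have h := sum_stepMatrix_mul_lyapunovStep x y rfl (by linarith) (ha n) (hb n) (hg n)
          linarith
      _ ≤ _ := by linarith [hR _ h1]

/-! ### Killed supermartingale and non-escape -/

/-- The walk along a deterministic trajectory. -/
abbrev position (y : ℕ → Direction 2) (n : ℕ) : Fin 2 → ℤ :=
  walk 0 (fun k (y : ℕ → Direction 2) => y k) n y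

theorem position_congr {y y' : ℕ → Direction 2} {n : ℕ}
    (h : ∀ k ∈ Finset.Icc 1 n, y k = y' k) : position y n = position y' n := by
  simp only [position, walk]
  rw [Finset.sum_congr rfl fun k hk => by rw [h k hk]]

theorem position_succ (y : ℕ → Direction 2) (n : ℕ) :
    position y (n + 1) = position y n + unitVec (y (n + 1)) := by
  simp only [position, walk]
  rw [Finset.sum_Icc_succ_top (by omega), add_assoc]

open Classical in
/-- The Lyapunov function along a trajectory at time `N + n`, set to zero once the walk has
visited the ball of squared radius `R` between the times `N + K` and `N + n`. -/
noncomputable def stoppedLyapunov (a b g : ℕ → ℝ) (R : ℝ) (N K n : ℕ) (y : ℕ → Direction 2) :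
    ℝ≥0∞ :=
  if ∀ j ∈ Finset.Icc K n, R ≤ normSq (position y (N + j)) then
    ENNReal.ofReal (lyapunov (a n) (b n) (g n) (normSq (position y (N + n)))
      (dirInner (position y (N + n)) (y (N + n))))
  else 0

theorem dependsOnFirst_stoppedLyapunov (a b g : ℕ → ℝ) (R : ℝ) {N : ℕ} (hN : 1 ≤ N) (K n : ℕ) :
    DependsOnFirst (N + n) (stoppedLyapunov a b g R N K n) := by
  intro y y' h
  have hpos : ∀ j ≤ n, position y (N + j) = position y' (N + j) := fun j hj =>
    position_congr fun k hk => h k (Finset.Icc_subset_Icc_right (by omega) hk)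
  have hy : y (N + n) = y' (N + n) := h _ (Finset.mem_Icc.2 ⟨by omega, le_rfl⟩)
  have hall : (∀ j ∈ Finset.Icc K n, R ≤ normSq (position y (N + j))) ↔
      ∀ j ∈ Finset.Icc K n, R ≤ normSq (position y' (N + j)) :=
    forall₂_congr fun j hj => by rw [hpos j (Finset.mem_Icc.1 hj).2]
  unfold stoppedLyapunov
  rw [hpos n le_rfl, hy]
  simp only [hall]

section Walk

variable {Ω : Type*} [MeasurableSpace Ω] {P : Measure Ω} [IsProbabilityMeasure P]
  {p : ℕ → ℝ} {Y : ℕ → Ω → Direction 2}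

-- Testing the ball only up to time `N + n` gives an upper bound `G` whose dependence on the last
-- direction is explicit, so the Markov property and the drift inequality apply.
open Classical in
theorem lintegral_stoppedLyapunov_succ_le (hY : IsDirectionChain P 2 p Y) {a b g : ℕ → ℝ}
    {R : ℝ} {N : ℕ} (hN : 1 ≤ N) (hp : ∀ n, p (N + n) ∈ Set.Icc (0 : ℝ) 1)
    (hR : ∀ (n : ℕ) (x : Fin 2 → ℤ) (y : Direction 2), R ≤ normSq x →
      (∀ z, 0 ≤ lyapunov (a (n + 1)) (b (n + 1)) (g (n + 1)) (normSq (x + unitVec z))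
        (dirInner (x + unitVec z) z)) ∧
      ∑ z, stepMatrix 2 (p (N + n)) y z * lyapunov (a (n + 1)) (b (n + 1)) (g (n + 1))
        (normSq (x + unitVec z)) (dirInner (x + unitVec z) z)
        ≤ lyapunov (a n) (b n) (g n) (normSq x) (dirInner x y)) {K n : ℕ} (hK : K ≤ n) :
    ∫⁻ ω, stoppedLyapunov a b g R N K (n + 1) (fun k => Y k ω) ∂P ≤
      ∫⁻ ω, stoppedLyapunov a b g R N K n (fun k => Y k ω) ∂P := by
  set G : (ℕ → Direction 2) → Direction 2 → ℝ≥0∞ := fun y z =>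
    if ∀ j ∈ Finset.Icc K n, R ≤ normSq (position y (N + j)) then
      ENNReal.ofReal (lyapunov (a (n + 1)) (b (n + 1)) (g (n + 1))
        (normSq (position y (N + n) + unitVec z)) (dirInner (position y (N + n) + unitVec z) z))
    else 0 with hG
  have hdep : DependsOnFirst (N + n) G := by
    intro y y' h
    have hpos : ∀ j ≤ n, position y (N + j) = position y' (N + j) := fun j hj =>
      position_congr fun k hk => h k (Finset.Icc_subset_Icc_right (by omega) hk)
    have hall : (∀ j ∈ Finset.Icc K n, R ≤ normSq (position y (N + j))) ↔
        ∀ j ∈ Finset.Icc K n, R ≤ normSq (position y' (N + j)) :=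
      forall₂_congr fun j hj => by rw [hpos j (Finset.mem_Icc.1 hj).2]
    funext z
    simp only [hG]
    rw [hpos n le_rfl]
    simp only [hall]
  calc ∫⁻ ω, stoppedLyapunov a b g R N K (n + 1) (fun k => Y k ω) ∂P
      ≤ ∫⁻ ω, G (fun k => Y k ω) (Y (N + n + 1) ω) ∂P := by
        refine lintegral_mono fun ω => ?_
        simp only [stoppedLyapunov, hG]
        by_cases h : ∀ j ∈ Finset.Icc K (n + 1), R ≤ normSq (position (fun k => Y k ω) (N + j))
        · rw [if_pos h, if_pos fun j hj => h j (Finset.Icc_subset_Icc_right (by omega) hj),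
            ← add_assoc, position_succ]
        · rw [if_neg h]
          exact zero_le
    _ = ∫⁻ ω, ∑ z, ENNReal.ofReal (stepMatrix 2 (p (N + n)) (Y (N + n) ω) z)
          * G (fun k => Y k ω) z ∂P := hY.lintegral_step (by omega) hdep
    _ ≤ ∫⁻ ω, stoppedLyapunov a b g R N K n (fun k => Y k ω) ∂P := by
        refine lintegral_mono fun ω => ?_
        simp only [stoppedLyapunov, hG]
        by_cases h : ∀ j ∈ Finset.Icc K n, R ≤ normSq (position (fun k => Y k ω) (N + j))
        · simp only [if_pos h]
          obtain ⟨h0, h1⟩ := hR n _ (Y (N + n) ω) (h n (Finset.mem_Icc.2 ⟨hK, le_rfl⟩))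
          simp_rw [← ENNReal.ofReal_mul (stepMatrix_nonneg (hp n) _ _)]
          -- Nonnegativity after the step is needed here: truncation at zero would otherwise not
          -- commute with the sum.
          rw [← ENNReal.ofReal_sum_of_nonneg fun z _ =>
            mul_nonneg (stepMatrix_nonneg (hp n) _ _) (h0 z)]
          exact ENNReal.ofReal_le_ofReal h1
        · simp only [if_neg h, mul_zero, Finset.sum_const_zero, le_refl]

/-- A walk with bounded coefficients of the Lyapunov function almost surely does not escape. -/
theorem measure_escapeEvent_eq_zero (hY : IsDirectionChain P 2 p Y) {a b g : ℕ → ℝ} {κ B : ℝ}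
    {N : ℕ} (hN : 1 ≤ N) (hp : ∀ n, p (N + n) ∈ Set.Icc (0 : ℝ) 1) (hκ : 0 < κ)
    (hA : ∀ n, |a n| ≤ B) (hB : ∀ n, |b n| ≤ B) (hG : ∀ n, |g n| ≤ B)
    (ha : ∀ n, a n = (1 - p (N + n)) * (1 + a (n + 1)))
    (hb : ∀ n, b n = (1 - p (N + n)) * (1 / 2 + a (n + 1) + b (n + 1)))
    (hg : ∀ n, g n = g (n + 1) + p (N + n) / 2 * (1 / 2 + a (n + 1) + b (n + 1)) - κ) :
    P (escapeEvent (walk 0 Y)) = 0 := by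
  obtain ⟨R, hR⟩ := exists_drift hp hκ hA hB hG ha hb hg
  set F : ℕ → ℕ → Ω → ℝ≥0∞ := fun K n ω =>
    stoppedLyapunov a b g R N K n (fun k => Y k ω) with hF
  have hmeas : ∀ K n, Measurable (F K n) := fun K n =>
    hY.measurable_of_dependsOnFirst (dependsOnFirst_stoppedLyapunov a b g R hN K n)
  have hle : ∀ K n, K ≤ n → ∫⁻ ω, F K n ω ∂P ≤ ∫⁻ ω, F K K ω ∂P := fun K n hn => by
    induction n, hn using Nat.le_induction with
    | base => exact le_rfl
    | succ n hn ih => exact (lintegral_stoppedLyapunov_succ_le hY hN hp hR hn).trans ih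
  have hfin : ∀ K, ∫⁻ ω, F K K ω ∂P ≠ ∞ := fun K =>
    lintegral_ne_top_of_dependsOnFirst (dependsOnFirst_stoppedLyapunov a b g R hN K K)
      fun y => by unfold stoppedLyapunov; split_ifs <;> simp
  -- Fatou's lemma with the uniform bound on expectations replaces martingale convergence.
  have hae : ∀ᵐ ω ∂P, ∀ K, liminf (fun n => F K n ω) atTop < ∞ := by
    refine ae_all_iff.2 fun K => ae_lt_top (Measurable.liminf (hmeas K)) ?_
    refine ne_top_of_le_ne_top (hfin K) ((lintegral_liminf_le (hmeas K)).trans ?_)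
    exact liminf_le_of_frequently_le'
      (eventually_atTop.2 ⟨K, fun n hn => hle K n hn⟩).frequently
  refine measure_mono_null (fun ω hω => ?_) hae
  intro hlt
  have hsq : Tendsto (fun n => normSq (position (fun k => Y k ω) (N + n))) atTop atTop := by
    have h1 : Tendsto (fun n => euclNorm (walk 0 Y n ω)) atTop atTop := hω
    have h2 := ((tendsto_pow_atTop two_ne_zero).comp h1).comp (tendsto_add_atTop_nat N)
    refine h2.congr fun n => ?_
    rw [Function.comp, Function.comp, euclNorm_sq, add_comm n N]
    rfl
  -- From time `N + K` on the escaping path avoids the ball, so the process started at this `K` is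
  -- never killed.
  obtain ⟨K, hK⟩ := eventually_atTop.1 (hsq.eventually_ge_atTop R)
  have hlim : Tendsto (fun n => F K n ω) atTop (nhds ∞) := by
    have hlog := tendsto_atTop_add_const_right atTop (-(1 + 17 * B))
      (Real.tendsto_log_atTop.comp hsq)
    have hV : Tendsto (fun n => lyapunov (a n) (b n) (g n)
        (normSq (position (fun k => Y k ω) (N + n)))
        (dirInner (position (fun k => Y k ω) (N + n)) (Y (N + n) ω))) atTop atTop := by
      refine tendsto_atTop_mono' _ ?_ hlog
      filter_upwards [hsq.eventually_ge_atTop 1] with n hn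
      exact lyapunov_ge (hA n) (hB n) (hG n) hn (dirInner_sq_le _ _)
    refine (ENNReal.tendsto_ofReal_atTop.comp hV).congr fun n => ?_
    simp only [hF, stoppedLyapunov, Function.comp]
    rw [if_pos fun j hj => hK j (Finset.mem_Icc.1 hj).1]
  exact (hlt K).ne hlim.liminf_eq

end Walk

/-- Divergence of the series enters only here: it excludes that refreshment eventually stops, which
would give `κ = 0`. -/
theorem exists_pos_of_not_summable {p : ℕ → ℝ} {N : ℕ}
    (hp : ∀ n, p (N + n) ∈ Set.Icc (0 : ℝ) 1) (hsum : ¬ Summable p) : ∃ n, 0 < p (N + n) := by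
  by_contra! h
  refine hsum ((summable_nat_add_iff N).1 ?_)
  have : (fun n => p (n + N)) = fun _ => 0 := funext fun n => by
    rw [add_comm]
    exact le_antisymm (h n) (hp n).1
  rw [this]
  exact summable_zero

end ConservativeWalk

theorem theorem5 {Ω : Type*} [MeasurableSpace Ω] (P : Measure Ω) [IsProbabilityMeasure P]
    (p : ℕ → ℝ) (hp : ∀ n, 1 ≤ n → p n ∈ Set.Icc (0 : ℝ) 1)
    (hsum : ¬ Summable p)
    (r n₀ : ℕ) (hr : 1 ≤ r) (hper : ∀ n, n₀ ≤ n → p (n + r) = p n)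
    (Y : ℕ → Ω → ConservativeWalk.Direction 2)
    (hY : ConservativeWalk.IsDirectionChain P 2 p Y) :
    ¬ ConservativeWalk.StronglyTransient P (ConservativeWalk.walk 0 Y) ∧
      P (ConservativeWalk.escapeEvent (ConservativeWalk.walk 0 Y)) = 0 := by
  -- Starting at `max n₀ 1` secures periodicity and avoids `p 0`, which is unconstrained.
  have hN : 1 ≤ max n₀ 1 := le_max_right _ _
  have hmem : ∀ n, p (max n₀ 1 + n) ∈ Set.Icc (0 : ℝ) 1 := fun n => hp _ (by omega)
  obtain ⟨a, b, g, κ, B, hκ, hA, hB, hG, ha, hb, hg⟩ :=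
    ConservativeWalk.exists_coefficients (q := fun n => p (max n₀ 1 + n)) hr
      (fun n => by rw [← add_assoc]; exact hper _ (by omega)) hmem
      (ConservativeWalk.exists_pos_of_not_summable hmem hsum)
  have h0 := ConservativeWalk.measure_escapeEvent_eq_zero hY hN hmem hκ hA hB hG ha hb hg
  refine ⟨fun h => ?_, h0⟩
  rw [ConservativeWalk.StronglyTransient, h0] at h
  exact zero_ne_one h
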